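/- **Lariats.** For a finite simple graph $G$, let $X_G=\sum_\kappa\prod_{v\in V(G)}x_{\kappa(v)}$ be its chromatic symmetric function in the variables $x_1,x_2,\dots$, where $\kappa$ runs over all proper colorings of $G$ by positive integers. For $k\ge 0$ let $e_k=\sum_{1\le j_1<\dots<j_k}x_{j_1}\dotsm x_{j_k}$. For a composition $I=i_1i_2\dotsm i_s$ of $n$ (a sequence of positive integers with sum $n$, written $I\vDash n$), let $e_I=e_{i_1}e_{i_2}\dotsm e_{i_s}$, $w_I=i_1\prod_{j=2}^{s}(i_j-1)$, and let $i_{-1}=i_s$ be its last part. For $n\ge 3$, let the lariat $T_{3,n-3}$ be the graph obtained from a triangle and a path with $n-3$ vertices by adding an edge that connects a vertex of the triangle with an end of the path (for $n=3$ it is the triangle itself). Then, for every $n\ge 3$, $$X_{T_{3,n-3}}=2\sum_{I\vDash n,\ i_{-1}\ge 3}w_I\,e_I .$$ -/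

import Mathlib

noncomputable section

namespace Chromatic

/-- Formal power series over `R` in the countably many variables `x_1, x_2, x_3, …`. -/
abbrev Series (R : Type*) := MvPowerSeries ℕ+ R

/-- The exponent vector of the monomial `∏_v x_{κ(v)}`. -/
def colorExponent {V : Type*} [Fintype V] (κ : V → ℕ+) : ℕ+ →₀ ℕ :=
  ∑ v, Finsupp.single (κ v) 1

/-- The monomial `∏_v x_{κ(v)}` has exponent vector `colorExponent κ`. -/
theorem prod_X_eq_monomial (R : Type*) [CommRing R] {V : Type*} [Fintype V] (κ : V → ℕ+) :
    (∏ v, (MvPowerSeries.X (κ v) : Series R)) = MvPowerSeries.monomial (colorExponent κ) 1 := by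
  classical
  unfold colorExponent
  induction (Finset.univ : Finset V) using Finset.induction_on with
  | empty => simp
  | insert a s ha ih =>
    rw [Finset.prod_insert ha, Finset.sum_insert ha, ih, MvPowerSeries.X_def,
      MvPowerSeries.monomial_mul_monomial, one_mul]

/-- Only finitely many colorings contribute to a given monomial. -/
theorem finite_colorings {V : Type*} [Fintype V] (G : SimpleGraph V) (d : ℕ+ →₀ ℕ) :
    {κ : G.Coloring ℕ+ | colorExponent κ = d}.Finite := by
  classical
  have h : (Set.pi Set.univ (fun _ : V => (d.support : Set ℕ+))).Finite :=
    Set.Finite.pi fun _ => d.support.finite_toSet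
  refine Set.Finite.subset (h.preimage (f := fun κ : G.Coloring ℕ+ => (κ : V → ℕ+))
    DFunLike.coe_injective.injOn) ?_
  rintro κ rfl v -
  simp only [Finset.mem_coe, Finsupp.mem_support_iff, colorExponent, Finsupp.finsetSum_apply]
  intro h0
  have := Finset.sum_eq_zero_iff.mp h0 v (Finset.mem_univ v)
  simp at this

/-- The chromatic symmetric function `X_G = ∑_κ ∏_v x_{κ(v)}`, the sum over all proper colorings
`κ` of `G` by positive integers: the coefficient at `d` is the number of
proper colorings whose monomial is `x^d`. -/
def chromaticSymm (R : Type*) [CommRing R] {V : Type*} [Fintype V] (G : SimpleGraph V) :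
    Series R :=
  fun d => (({κ : G.Coloring ℕ+ | colorExponent κ = d}.ncard : ℕ) : R)

open Classical in
/-- The elementary symmetric function `e_k = ∑_{i_1 < ⋯ < i_k} x_{i_1} ⋯ x_{i_k}`: the sum of all
squarefree monomials of degree `k`. -/
def elemSymm (R : Type*) [CommRing R] (k : ℕ) : Series R :=
  fun d => if (∀ i, d i ≤ 1) ∧ d.degree = k then 1 else 0

/-- `e_I = e_{i_1} e_{i_2} ⋯` for a composition `I = i_1 i_2 ⋯`. -/
def elemSymmComp (R : Type*) [CommRing R] {n : ℕ} (I : Composition n) : Series R :=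
  (I.blocks.map (elemSymm R)).prod

/-- `i_1 ∏_{j ≥ 2} (i_j - 1)` for a list `i_1, i_2, …` (and `1` for the empty list). -/
def listWeight : List ℕ → ℤ
  | [] => 1
  | i :: J => (i : ℤ) * (J.map fun j => (j : ℤ) - 1).prod

/-- `w_I = i_1 ∏_{j ≥ 2} (i_j - 1)` for a composition `I`. -/
def weight {n : ℕ} (I : Composition n) : ℤ := listWeight I.blocks

/-- The last part `i_{-1}` of a composition (`0` for the empty composition of `0`). -/
def lastPart {n : ℕ} (I : Composition n) : ℕ := I.blocks.getLastD 0

/-- The tadpole `T_{m,l}`: the disjoint union of the cycle `C_m` and the path `P_l`, together with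
an edge joining the vertex `0` of the cycle to the end `0` of the path (no edge if `l = 0`). -/
def tadpole (m l : ℕ) : SimpleGraph (Fin m ⊕ Fin l) :=
  (SimpleGraph.cycleGraph m ⊕g SimpleGraph.pathGraph l) ⊔
    SimpleGraph.fromRel fun u v =>
      ∃ (i : Fin m) (j : Fin l), i.val = 0 ∧ j.val = 0 ∧ u = Sum.inl i ∧ v = Sum.inr j

end Chromatic

end

noncomputable section

namespace Chromatic

open Finset

/-! Setting all but finitely many variables to zero loses nothing, since each coefficient involves
finitely many variables; all colorings then take values in a finite set. Let `W_n` (`wordSum`) be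
the sum of the monomials of words of length `n` without equal neighbours, i.e. the chromatic
function of the path. Two facts give the theorem. First, `W_n = ∑ w_I e_I` over all compositions of
`n`: both sides satisfy `W_n = ∑ (k-1) e_k W_{n-k} + e_n`, on the right by removing the last part,
on the left by reading coefficients in `W·E = E + tE'·W` with `E = ∏ (1 + x_a t)`
(`weightedSum_coeff_elemGen`). Second, the lariat equals `2 (W_n - e_2 W_{n-2})`
(`sum_triangle_headSum`). Among the compositions, last part 1 has weight zero and last part 2
contributes exactly `e_2 W_{n-2}`, so the difference is the sum over last part at least 3. -/

/-! ### Sums over compositions, decomposed by the last part -/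

/-- Appending a last part `k` to a composition of `n - k`. -/
def appendPart {n k : ℕ} (h1 : 1 ≤ k) (hk : k ≤ n) (J : Composition (n - k)) : Composition n where
  blocks := J.blocks ++ [k]
  blocks_pos := by
    intro i hi
    rcases List.mem_append.mp hi with h | h
    · exact J.blocks_pos h
    · rw [List.mem_singleton.mp h]; exact h1
  blocks_sum := by
    rw [List.sum_append, J.blocks_sum, List.sum_singleton]; omega

theorem sum_composition_eq_sum_last {M : Type*} [AddCommMonoid M] {n : ℕ} (hn : 1 ≤ n)
    (g : List ℕ → M) :
    ∑ I : Composition n, g I.blocks =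
      ∑ k ∈ Icc 1 n, ∑ J : Composition (n - k), g (J.blocks ++ [k]) := by
  rw [Finset.sum_sigma']
  symm
  refine Finset.sum_bij
    (fun p hp => appendPart (mem_Icc.mp (mem_sigma.mp hp).1).1
      (mem_Icc.mp (mem_sigma.mp hp).1).2 p.2)
    (fun _ _ => mem_univ _) ?_ ?_ (fun _ _ => rfl)
  · rintro ⟨k, J⟩ hp ⟨k', J'⟩ hp' h
    have hb : J.blocks ++ [k] = J'.blocks ++ [k'] := congrArg Composition.blocks h
    obtain ⟨h1, h2⟩ := List.append_inj' hb rfl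
    obtain rfl : k = k' := by simpa using h2
    obtain rfl : J = J' := Composition.ext h1
    rfl
  · intro I _
    have hne : I.blocks ≠ [] := by
      intro h
      have := I.blocks_sum
      simp [h] at this
      omega
    have hI := List.dropLast_append_getLast hne
    have hs := I.blocks_sum
    rw [← hI, List.sum_append, List.sum_singleton] at hs
    have hpos : 0 < I.blocks.getLast hne := I.blocks_pos (List.getLast_mem hne)
    refine ⟨⟨I.blocks.getLast hne, ⟨I.blocks.dropLast, ?_, by omega⟩⟩, ?_, ?_⟩
    · intro i hi
      exact I.blocks_pos (List.mem_of_mem_dropLast hi)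
    · simp only [mem_sigma, mem_Icc, mem_univ, and_true]; omega
    · exact Composition.ext hI

/-- A first part weighs `k`, any later part `k - 1`; the correction term accounts for `k` being both
first and last. -/
theorem listWeight_append_singleton (L : List ℕ) (k : ℕ) :
    listWeight (L ++ [k]) = ((k : ℤ) - 1) * listWeight L + if L = [] then 1 else 0 := by
  cases L with
  | nil => simp [listWeight]
  | cons a L => simp [listWeight]; ring

variable {A : Type*} [CommRing A]

/-- `w_I e_I` for a list `I` of parts, where `e` is an arbitrary sequence. -/
def weightedTerm (e : ℕ → A) (L : List ℕ) : A := listWeight L • (L.map e).prod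

/-- `∑ w_I e_I` over all compositions of `n`, where `e` is an arbitrary sequence. -/
def weightedSum (e : ℕ → A) (n : ℕ) : A := ∑ I : Composition n, weightedTerm e I.blocks

theorem weightedTerm_append_singleton (e : ℕ → A) (L : List ℕ) (k : ℕ) :
    weightedTerm e (L ++ [k]) =
      ((k : A) - 1) * e k * weightedTerm e L + if L = [] then e k else 0 := by
  unfold weightedTerm
  rw [listWeight_append_singleton]
  split_ifs with h
  · subst h; simp [listWeight]; ring
  · simp [zsmul_eq_mul]; ring

theorem blocks_eq_nil_iff {n : ℕ} (J : Composition n) : J.blocks = [] ↔ n = 0 := by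
  constructor
  · intro h
    have := J.blocks_sum
    simpa [h] using this.symm
  · rintro rfl
    by_contra h
    obtain ⟨a, ha⟩ := List.exists_mem_of_ne_nil _ h
    have h1 := J.blocks_pos ha
    have h2 := List.le_sum_of_mem ha
    rw [J.blocks_sum] at h2
    omega

theorem sum_weightedTerm_append_singleton (e : ℕ → A) (m k : ℕ) :
    ∑ J : Composition m, weightedTerm e (J.blocks ++ [k]) =
      ((k : A) - 1) * e k * weightedSum e m + if m = 0 then e k else 0 := by
  simp_rw [weightedTerm_append_singleton, blocks_eq_nil_iff]
  rw [sum_add_distrib, ← mul_sum]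
  congr 1
  split_ifs with h
  · subst h; simp [composition_card]
  · simp

theorem weightedSum_zero (e : ℕ → A) : weightedSum e 0 = 1 := by
  have h : ∀ I : Composition 0, weightedTerm e I.blocks = 1 := by
    intro I
    rw [(blocks_eq_nil_iff I).mpr rfl]
    simp [weightedTerm, listWeight]
  simp [weightedSum, h, composition_card]

theorem weightedSum_eq {n : ℕ} (hn : 1 ≤ n) (e : ℕ → A) :
    weightedSum e n = ∑ k ∈ Icc 1 n, ((k : A) - 1) * e k * weightedSum e (n - k) + e n := by
  rw [weightedSum, sum_composition_eq_sum_last hn (weightedTerm e)]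
  simp_rw [sum_weightedTerm_append_singleton]
  rw [sum_add_distrib]
  congr 1
  rw [sum_eq_single n]
  · simp
  · intro k hk hkn
    rw [mem_Icc] at hk
    rw [if_neg (by omega)]
  · intro h
    exact absurd (mem_Icc.mpr ⟨hn, le_rfl⟩) h

/-- The compositions with last part at least three. -/
theorem sum_filter_three_le_lastPart {n : ℕ} (hn : 3 ≤ n) (e : ℕ → A) :
    ∑ I : Composition n with 3 ≤ lastPart I, weightedTerm e I.blocks =
      weightedSum e n - e 2 * weightedSum e (n - 2) := by
  have h1 : ∑ I : Composition n with 3 ≤ lastPart I, weightedTerm e I.blocks =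
      ∑ k ∈ Icc 1 n, ∑ J : Composition (n - k),
        if 3 ≤ k then weightedTerm e (J.blocks ++ [k]) else 0 := by
    rw [sum_filter]
    refine (sum_composition_eq_sum_last (by omega)
      (fun L => if 3 ≤ L.getLastD 0 then weightedTerm e L else 0)).trans ?_
    simp
  -- The terms `k = 1` and `k = 2` are peeled off both sums; the remaining ones agree.
  rw [h1, weightedSum, sum_composition_eq_sum_last (by omega) (weightedTerm e),
    ← Finset.add_sum_Ioc_eq_sum_Icc (by omega), ← Finset.add_sum_Ioc_eq_sum_Icc (by omega),
    ← Finset.Icc_succ_left_eq_Ioc, ← Finset.add_sum_Ioc_eq_sum_Icc (by simp; omega),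
    ← Finset.add_sum_Ioc_eq_sum_Icc (by simp; omega)]
  have h2 : ∀ k ∈ Ioc (Order.succ 1) n, (∑ J : Composition (n - k),
      if 3 ≤ k then weightedTerm e (J.blocks ++ [k]) else 0) =
      ∑ J : Composition (n - k), weightedTerm e (J.blocks ++ [k]) := by
    intro k hk
    have : 3 ≤ k := (mem_Ioc.mp hk).1
    simp [this]
  rw [sum_congr rfl h2]
  have h3 : Order.succ 1 = 2 := rfl
  rw [h3]
  simp only [sum_weightedTerm_append_singleton]
  -- As `n ≥ 3`, neither `n - 1` nor `n - 2` is zero, so no one-part correction occurs; the `k = 1`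
  -- term then dies by its factor `k - 1`.
  rw [if_neg (by omega), if_neg (by omega)]
  simp
  ring

/-! ### Weight enumerators of words without equal neighbours -/

/-- No two neighbouring letters of the word `w` are equal. -/
def IsProperWord {ι : Type*} {n : ℕ} (w : Fin n → ι) : Prop :=
  ∀ i j : Fin n, i.val + 1 = j.val → w i ≠ w j

/-- The word `w` does not start with the letter `a`. -/
def AvoidsHead {ι : Type*} {n : ℕ} (a : ι) (w : Fin n → ι) : Prop :=
  ∀ j : Fin n, j.val = 0 → a ≠ w j

theorem isProperWord_cons {ι : Type*} {n : ℕ} (a : ι) (w : Fin n → ι) :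
    IsProperWord (Fin.cons a w : Fin (n + 1) → ι) ↔ AvoidsHead a w ∧ IsProperWord w := by
  constructor
  · intro h
    refine ⟨fun j hj => ?_, fun i j hij => ?_⟩
    · simpa using h 0 j.succ (by simp [hj])
    · simpa using h i.succ j.succ (by simp [hij])
  · rintro ⟨h1, h2⟩ i j hij
    refine Fin.cases (fun h => by simp at h) (fun j hij => ?_) j hij
    revert hij
    refine Fin.cases (fun h => ?_) (fun i h => ?_) i
    · simpa using h1 j (by simpa using h.symm)
    · simpa using h2 i j (by simpa using h)

theorem avoidsHead_cons {ι : Type*} {n : ℕ} (a b : ι) (w : Fin n → ι) :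
    AvoidsHead a (Fin.cons b w : Fin (n + 1) → ι) ↔ a ≠ b := by
  constructor
  · intro h
    simpa using h 0 rfl
  · intro h j hj
    obtain rfl : j = 0 := Fin.ext hj
    simpa using h

variable {ι : Type*} [Fintype ι]

open Classical in
/-- The sum of the monomials of all proper words of length `n + 1` that start with `a`. -/
def headSum (x : ι → A) (n : ℕ) (a : ι) : A :=
  x a * ∑ w : Fin n → ι with AvoidsHead a w ∧ IsProperWord w, ∏ i, x (w i)

theorem headSum_zero (x : ι → A) (a : ι) : headSum x 0 a = x a := by
  classical
  unfold headSum
  rw [filter_true_of_mem]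
  · simp
  · intro w _
    exact ⟨fun j => j.elim0, fun j => j.elim0⟩

theorem headSum_succ (x : ι → A) (n : ℕ) (a : ι) :
    headSum x (n + 1) a = x a * (∑ b, headSum x n b - headSum x n a) := by
  classical
  have h : ∑ b, headSum x n b - headSum x n a = ∑ b, if a ≠ b then headSum x n b else 0 := by
    rw [← Finset.sum_filter, sub_eq_iff_eq_add, Finset.filter_ne,
      Finset.sum_erase_add _ _ (mem_univ a)]
  rw [h, headSum, sum_filter, ← (Fin.consEquiv (fun _ => ι)).sum_comp, Fintype.sum_prod_type]
  congr 1
  have hcons : ∀ (b : ι) (w : Fin n → ι),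
      Fin.consEquiv (fun _ => ι) (b, w) = (Fin.cons b w : Fin (n + 1) → ι) := fun _ _ => rfl
  refine sum_congr rfl fun b _ => ?_
  simp only [hcons, isProperWord_cons, avoidsHead_cons, Fin.prod_univ_succ,
    Fin.cons_zero, Fin.cons_succ]
  split_ifs with hab
  · rw [headSum, sum_filter, mul_sum]
    simp [hab]
  · simp [hab]

/-- The sum of the monomials of all proper words of length `n`, through its recursion. -/
def wordSum (x : ι → A) : ℕ → A
  | 0 => 1
  | n + 1 => ∑ a, headSum x n a

open PowerSeries in
/-- The generating function of the elementary symmetric functions in the `x a`. -/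
def elemGen (x : ι → A) : PowerSeries A := ∏ a, (1 + C (x a) * X)

/-- The product rule, in a form that avoids dividing by `1 + x_a t`. -/
theorem X_mul_derivative_elemGen [DecidableEq ι] (x : ι → A) :
    PowerSeries.X * PowerSeries.derivative A (elemGen x) =
      ∑ a, PowerSeries.C (x a) * PowerSeries.X *
        ∏ b ∈ univ.erase a, (1 + PowerSeries.C (x b) * PowerSeries.X) := by
  unfold elemGen
  induction (univ : Finset ι) using Finset.induction_on with
  | empty => simp
  | insert c s hc ih =>
    have h : ∀ a ∈ s, PowerSeries.C (x a) * PowerSeries.X *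
        ∏ b ∈ (insert c s).erase a, (1 + PowerSeries.C (x b) * PowerSeries.X) =
        (1 + PowerSeries.C (x c) * PowerSeries.X) * (PowerSeries.C (x a) * PowerSeries.X *
          ∏ b ∈ s.erase a, (1 + PowerSeries.C (x b) * PowerSeries.X)) := by
      intro a ha
      rw [erase_insert_of_ne (ne_of_mem_of_not_mem ha hc).symm,
        prod_insert (fun h => hc (mem_of_mem_erase h))]
      ring
    rw [prod_insert hc, sum_insert hc, erase_insert hc, sum_congr rfl h, ← mul_sum, ← ih]
    simp [Derivation.leibniz]
    ring

/-- Let `F_a` enumerate the nonempty words starting with `a`. What follows `a` is any word not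
starting with `a`, so `F_a = x_a t (W - F_a)`, that is, `F_a (1 + x_a t) = x_a t W`. Multiplying `W
= 1 + ∑ F_a` by `E` gives the identity. -/
theorem mk_wordSum_mul_elemGen (x : ι → A) :
    PowerSeries.mk (wordSum x) * elemGen x =
      elemGen x + PowerSeries.X * PowerSeries.derivative A (elemGen x) *
        PowerSeries.mk (wordSum x) := by
  classical
  set F : ι → PowerSeries A :=
    fun a => PowerSeries.X * PowerSeries.mk (fun n => headSum x n a) with hF
  have h1 : PowerSeries.mk (wordSum x) = 1 + ∑ a, F a := by
    ext n
    cases n with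
    | zero => simp [wordSum, hF]
    | succ n => simp [wordSum, hF, PowerSeries.coeff_succ_X_mul, PowerSeries.coeff_one]
  have h2 : ∀ a, F a * (1 + PowerSeries.C (x a) * PowerSeries.X) =
      PowerSeries.C (x a) * PowerSeries.X * PowerSeries.mk (wordSum x) := by
    intro a
    have h3 : PowerSeries.mk (fun n => headSum x n a) =
        PowerSeries.C (x a) * (PowerSeries.mk (wordSum x) - F a) := by
      ext n
      cases n with
      | zero => simp [wordSum, hF, headSum_zero]
      | succ n => simp [wordSum, hF, PowerSeries.coeff_succ_X_mul, headSum_succ]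
    have h4 : F a = PowerSeries.X * (PowerSeries.C (x a) * (PowerSeries.mk (wordSum x) - F a)) := by
      rw [← h3]
    linear_combination h4
  rw [X_mul_derivative_elemGen, sum_mul]
  nth_rewrite 1 [h1]
  rw [add_mul, one_mul, sum_mul]
  congr 1
  refine sum_congr rfl fun a _ => ?_
  rw [elemGen, ← Finset.mul_prod_erase univ _ (mem_univ a), ← mul_assoc, h2]
  ring

theorem wordSum_eq (x : ι → A) (n : ℕ) :
    wordSum x n = ∑ k ∈ Icc 1 n,
      ((k : A) - 1) * PowerSeries.coeff k (elemGen x) * wordSum x (n - k) +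
        PowerSeries.coeff n (elemGen x) := by
  have h := congrArg (PowerSeries.coeff n) (mk_wordSum_mul_elemGen x)
  rw [mul_comm, map_add, PowerSeries.coeff_mul, PowerSeries.coeff_mul,
    Nat.sum_antidiagonal_eq_sum_range_succ_mk, Nat.sum_antidiagonal_eq_sum_range_succ_mk] at h
  have h0 : PowerSeries.coeff 0 (elemGen x) = 1 := by
    simp [elemGen, map_prod]
  have hd : ∀ k, PowerSeries.coeff k (PowerSeries.X * PowerSeries.derivative A (elemGen x)) =
      (k : A) * PowerSeries.coeff k (elemGen x) := by
    intro k
    cases k with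
    | zero => simp
    | succ k =>
      rw [PowerSeries.coeff_succ_X_mul, PowerSeries.coeff_derivative]
      push_cast; ring
  simp only [hd, PowerSeries.coeff_mk] at h
  -- At `k = 0`, `E` has coefficient 1 and `tE'` has 0; splitting off this term isolates `W_n`.
  rw [Finset.sum_range_eq_add_Ico _ n.succ_pos, Finset.sum_range_eq_add_Ico _ n.succ_pos, h0] at h
  have hI : Icc 1 n = Ico 1 n.succ := by ext; simp
  rw [hI]
  simp only [sub_mul, one_mul, sum_sub_distrib]
  simp at h ⊢
  linear_combination h

theorem weightedSum_coeff_elemGen (x : ι → A) (n : ℕ) :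
    weightedSum (fun k => PowerSeries.coeff k (elemGen x)) n = wordSum x n := by
  induction n using Nat.strong_induction_on with
  | _ n ih =>
    rcases Nat.eq_zero_or_pos n with rfl | hn
    · rw [weightedSum_zero]; rfl
    · rw [weightedSum_eq hn, wordSum_eq]
      congr 1
      refine sum_congr rfl fun k hk => ?_
      rw [mem_Icc] at hk
      rw [ih (n - k) (by omega)]

open Classical in
/-- Triple deletion for the triangle of a lariat. -/
theorem sum_triangle_headSum (x : ι → A) (l : ℕ) :
    ∑ a, ∑ b, ∑ c, (if a ≠ b ∧ a ≠ c ∧ b ≠ c then x b * x c * headSum x l a else 0) =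
      2 * (wordSum x (l + 3) - PowerSeries.coeff 2 (elemGen x) * wordSum x (l + 1)) := by
  -- Both sides enumerate the proper words of length 2.
  have hw2 : (∑ a, x a) ^ 2 - ∑ a, x a ^ 2 = 2 * PowerSeries.coeff 2 (elemGen x) := by
    have h1 : wordSum x 2 = (∑ a, x a) ^ 2 - ∑ a, x a ^ 2 := by
      simp only [wordSum, headSum_succ, headSum_zero, mul_sub, sum_sub_distrib, ← sum_mul]
      simp only [pow_two]
    have h2 := wordSum_eq x 2
    rw [show Icc 1 2 = {1, 2} from rfl] at h2
    rw [← h1, h2]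
    simp [wordSum]
    ring
  -- Ordered pairs of distinct letters, both different from `a`.
  have hin : ∀ a, ∑ b, ∑ c, (if a ≠ b ∧ a ≠ c ∧ b ≠ c then x b * x c * headSum x l a else 0) =
      headSum x l a * ((∑ b, x b) ^ 2 - ∑ b, x b ^ 2 - 2 * x a * ∑ b, x b + 2 * x a ^ 2) := by
    intro a
    have hc : ∀ b, ∑ c, (if a ≠ b ∧ a ≠ c ∧ b ≠ c then x b * x c * headSum x l a else 0) =
        if a ≠ b then x b * (∑ c, x c - x a - x b) * headSum x l a else 0 := by
      intro b
      split_ifs with hab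
      · have : ∀ c, (if a ≠ b ∧ a ≠ c ∧ b ≠ c then x b * x c * headSum x l a else 0) =
            x b * headSum x l a * (x c - (if a = c then x c else 0) - (if b = c then x c else 0)) := by
          intro c
          by_cases h1 : a = c
          · subst h1; simp [Ne.symm hab]
          · by_cases h2 : b = c
            · subst h2; simp [hab]
            · simp [h1, h2, hab]; ring
        simp_rw [this]
        rw [← mul_sum, sum_sub_distrib, sum_sub_distrib]
        simp
        ring
      · simp [hab]
    simp_rw [hc]
    rw [← sum_filter, filter_ne, sum_erase_eq_sub (mem_univ a)]
    have : ∀ b, x b * (∑ c, x c - x a - x b) * headSum x l a =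
        headSum x l a * ((∑ c, x c - x a) * x b - x b ^ 2) := fun b => by ring
    simp_rw [this]
    rw [← mul_sum, sum_sub_distrib, ← mul_sum]
    ring
  -- Here `a` is the third letter: the letter before it differs from `a`, the first letter only from
  -- the second. Twice this factor minus `2 e_2` is the factor in `hin`.
  have hw3 : wordSum x (l + 3) = ∑ a, headSum x l a *
      ((∑ b, x b) ^ 2 - ∑ b, x b ^ 2 - x a * ∑ b, x b + x a ^ 2) := by
    simp only [wordSum, headSum_succ, mul_sub, mul_add, sum_sub_distrib, sum_add_distrib, ← sum_mul]
    have e1 : ∀ a, x a * (x a * ∑ b, headSum x l b) = x a ^ 2 * ∑ b, headSum x l b :=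
      fun a => by ring
    have e2 : ∀ a, x a * (x a * headSum x l a) = headSum x l a * x a ^ 2 := fun a => by ring
    have e3 : ∀ a, headSum x l a * (x a * ∑ b, x b) = (x a * headSum x l a) * ∑ b, x b :=
      fun a => by ring
    simp only [e1, e2, e3, ← sum_mul]
    ring
  simp_rw [hin]
  rw [hw3, mul_sub, ← mul_assoc, ← hw2, wordSum, mul_sum, mul_sum, ← sum_sub_distrib]
  refine sum_congr rfl fun a _ => ?_
  ring

/-! ### Restriction to finitely many variables -/

variable {R : Type*} [CommRing R]

/-- The ring homomorphism that sets the variables outside `S` to zero. -/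
def restrictVars (S : Finset ℕ+) : Series R →+* Series R where
  toFun f := fun d => if d.support ⊆ S then MvPowerSeries.coeff d f else 0
  map_one' := by
    classical
    ext d
    change (if d.support ⊆ S then MvPowerSeries.coeff d (1 : Series R) else 0) = _
    rw [MvPowerSeries.coeff_one]
    by_cases hd : d = 0
    · simp [hd]
    · simp [hd]
  map_zero' := by
    ext d
    change (if d.support ⊆ S then MvPowerSeries.coeff d (0 : Series R) else 0) = _
    simp
  map_add' f g := by
    ext d
    change (if d.support ⊆ S then MvPowerSeries.coeff d (f + g) else 0) =
      (if d.support ⊆ S then MvPowerSeries.coeff d f else 0) +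
        (if d.support ⊆ S then MvPowerSeries.coeff d g else 0)
    split_ifs <;> simp
  map_mul' f g := by
    classical
    ext d
    refine Eq.trans ?_ (MvPowerSeries.coeff_mul d _ _).symm
    change (if d.support ⊆ S then MvPowerSeries.coeff d (f * g) else 0) =
      ∑ p ∈ antidiagonal d, (if p.1.support ⊆ S then MvPowerSeries.coeff p.1 f else 0) *
        (if p.2.support ⊆ S then MvPowerSeries.coeff p.2 g else 0)
    rw [MvPowerSeries.coeff_mul]
    -- Exponents are natural numbers, so nothing cancels; this makes the truncation multiplicative.
    have hsupp : ∀ p ∈ antidiagonal d, d.support = p.1.support ∪ p.2.support := by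
      intro p hp
      rw [← mem_antidiagonal.mp hp]
      ext i
      simp only [Finsupp.mem_support_iff, Finsupp.add_apply, mem_union]
      omega
    split_ifs with hd
    · refine sum_congr rfl fun p hp => ?_
      rw [hsupp p hp, union_subset_iff] at hd
      rw [if_pos hd.1, if_pos hd.2]
    · symm
      refine sum_eq_zero fun p hp => ?_
      rw [hsupp p hp, union_subset_iff, not_and_or] at hd
      rcases hd with hd | hd <;> simp [hd]

theorem coeff_restrictVars (S : Finset ℕ+) (f : Series R) (d : ℕ+ →₀ ℕ) :
    MvPowerSeries.coeff d (restrictVars S f) =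
      if d.support ⊆ S then MvPowerSeries.coeff d f else 0 := rfl

theorem eq_of_restrictVars_eq {f g : Series R} (h : ∀ S, restrictVars S f = restrictVars S g) :
    f = g := by
  ext d
  have := congrArg (MvPowerSeries.coeff d) (h d.support)
  simpa [coeff_restrictVars] using this

theorem support_colorExponent_subset_iff {V : Type*} [Fintype V] (κ : V → ℕ+) (S : Finset ℕ+) :
    (colorExponent κ).support ⊆ S ↔ ∀ v, κ v ∈ S := by
  classical
  constructor
  · intro h v
    apply h
    rw [Finsupp.mem_support_iff, colorExponent, Finsupp.finsetSum_apply]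
    intro h0
    have := Finset.sum_eq_zero_iff.mp h0 v (Finset.mem_univ v)
    simp at this
  · intro h i hi
    rw [Finsupp.mem_support_iff, colorExponent, Finsupp.finsetSum_apply] at hi
    obtain ⟨v, -, hv⟩ := Finset.exists_ne_zero_of_sum_ne_zero hi
    rw [Finsupp.single_apply] at hv
    by_cases hvi : κ v = i
    · exact hvi ▸ h v
    · simp [hvi] at hv

open Classical in
theorem restrictVars_chromaticSymm {V : Type*} [Fintype V] (G : SimpleGraph V) (S : Finset ℕ+) :
    restrictVars S (chromaticSymm R G) =
      ∑ κ : V → S with ∀ u v, G.Adj u v → κ u ≠ κ v,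
        ∏ v, (MvPowerSeries.X (κ v : ℕ+) : Series R) := by
  ext d
  simp_rw [fun κ : V → S => prod_X_eq_monomial R (fun v => (κ v : ℕ+))]
  rw [coeff_restrictVars, map_sum]
  simp_rw [MvPowerSeries.coeff_monomial]
  rw [← sum_filter, sum_const, nsmul_one, filter_filter]
  split_ifs with hd
  · change (({κ : G.Coloring ℕ+ | colorExponent κ = d}.ncard : ℕ) : R) = _
    congr 1
    rw [← Set.ncard_coe_finset]
    symm
    refine Set.ncard_congr
      (fun κ hκ => SimpleGraph.Coloring.mk (fun v => (κ v : ℕ+)) fun {u v} huv h => ?_) ?_ ?_ ?_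
    · rw [mem_coe, mem_filter] at hκ
      exact hκ.2.1 u v huv (Subtype.ext h)
    · intro κ hκ
      rw [mem_coe, mem_filter] at hκ
      exact hκ.2.2.symm
    · intro κ κ' _ _ h
      funext v
      exact Subtype.ext (DFunLike.congr_fun h v)
    · intro κ hκ
      have hS : ∀ v, κ v ∈ S := by
        rw [← support_colorExponent_subset_iff]
        rw [Set.mem_ofPred_eq] at hκ
        rw [hκ]; exact hd
      refine ⟨fun v => ⟨κ v, hS v⟩, ?_, ?_⟩
      · rw [mem_coe, mem_filter]
        refine ⟨mem_univ _, fun u v huv h => κ.valid huv (congrArg Subtype.val h), hκ.symm⟩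
      · rfl
  · rw [filter_false_of_mem]
    · simp
    · rintro κ - ⟨-, rfl⟩
      exact hd ((support_colorExponent_subset_iff _ S).mpr fun v => (κ v).2)

/-- Expanding the product over subsets `t` of `S`, only `t = d.support` can contribute to the
coefficient at `d`, and only if `d` is squarefree. -/
theorem restrictVars_elemSymm (S : Finset ℕ+) (k : ℕ) :
    restrictVars S (elemSymm R k) =
      PowerSeries.coeff k (elemGen fun a : S => (MvPowerSeries.X (a : ℕ+) : Series R)) := by
  classical
  have hgen : elemGen (fun a : S => (MvPowerSeries.X (a : ℕ+) : Series R)) =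
      ∏ a ∈ S, (1 + PowerSeries.C (MvPowerSeries.X a : Series R) * PowerSeries.X) :=
    Finset.prod_coe_sort S
      (fun a => (1 + PowerSeries.C (MvPowerSeries.X a : Series R) * PowerSeries.X))
  have hprod : ∀ t : Finset ℕ+, ∏ a ∈ t, (MvPowerSeries.X a : Series R) =
      MvPowerSeries.monomial (∑ a ∈ t, Finsupp.single a 1) 1 := by
    intro t
    induction t using Finset.induction_on with
    | empty => simp
    | insert a s ha ih =>
      rw [prod_insert ha, sum_insert ha, ih, MvPowerSeries.X_def,
        MvPowerSeries.monomial_mul_monomial, one_mul]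
  have happ : ∀ (t : Finset ℕ+) (i : ℕ+),
      (∑ a ∈ t, Finsupp.single a 1 : ℕ+ →₀ ℕ) i = if i ∈ t then 1 else 0 := by
    intro t i
    simp [Finsupp.finsetSum_apply, Finsupp.single_apply]
  rw [hgen, Finset.prod_one_add, map_sum]
  have hterm : ∀ t : Finset ℕ+, PowerSeries.coeff k
      (∏ a ∈ t, PowerSeries.C (MvPowerSeries.X a : Series R) * PowerSeries.X) =
      if k = #t then MvPowerSeries.monomial (∑ a ∈ t, Finsupp.single a 1) (1 : R) else 0 := by
    intro t
    rw [prod_mul_distrib, prod_const, ← map_prod, PowerSeries.coeff_C_mul, PowerSeries.coeff_X_pow,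
      hprod]
    simp
  simp_rw [hterm]
  ext d
  rw [coeff_restrictVars, map_sum]
  have hcoeff : MvPowerSeries.coeff d (elemSymm R k) =
      if (∀ i, d i ≤ 1) ∧ d.degree = k then 1 else 0 := rfl
  have hd : ∀ t : Finset ℕ+, d = ∑ a ∈ t, Finsupp.single a 1 ↔ (∀ i, d i ≤ 1) ∧ t = d.support := by
    intro t
    constructor
    · rintro rfl
      refine ⟨fun i => ?_, ?_⟩
      · rw [happ]; split_ifs <;> simp
      · ext i
        rw [Finsupp.mem_support_iff, happ]
        simp
    · rintro ⟨h1, rfl⟩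
      ext i
      rw [happ]
      have := h1 i
      split_ifs with hi
      · rw [Finsupp.mem_support_iff] at hi; omega
      · simpa using hi
  have hdeg : (∀ i, d i ≤ 1) → d.degree = #d.support := by
    intro h
    rw [Finsupp.degree_apply, card_eq_sum_ones]
    refine sum_congr rfl fun i hi => ?_
    have := h i
    rw [Finsupp.mem_support_iff] at hi
    omega
  have hc : ∀ t : Finset ℕ+, MvPowerSeries.coeff d
      (if k = #t then MvPowerSeries.monomial (∑ a ∈ t, Finsupp.single a 1) (1 : R) else 0) =
      if t = d.support then (if (∀ i, d i ≤ 1) ∧ d.degree = k then 1 else 0) else 0 := by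
    intro t
    have hm : MvPowerSeries.coeff d
        (if k = #t then MvPowerSeries.monomial (∑ a ∈ t, Finsupp.single a 1) (1 : R) else 0) =
        if k = #t ∧ d = ∑ a ∈ t, Finsupp.single a 1 then 1 else 0 := by
      by_cases h : k = #t
      · rw [if_pos h, MvPowerSeries.coeff_monomial]
        exact if_congr (by simp [h]) rfl rfl
      · simp [h]
    rw [hm, ← ite_and]
    refine if_congr ((and_congr_right' (hd t)).trans ?_) rfl rfl
    constructor
    · rintro ⟨h1, h2, rfl⟩
      exact ⟨rfl, h2, (hdeg h2).trans h1.symm⟩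
    · rintro ⟨rfl, h2, h3⟩
      exact ⟨h3.symm.trans (hdeg h2), h2, rfl⟩
  simp_rw [hc]
  rw [hcoeff, Finset.sum_ite_eq']
  simp only [mem_powerset]

/-! ### Lariats -/

theorem tadpole_three_proper_iff {ι : Type*} {l : ℕ} (κ : Fin 3 ⊕ Fin l → ι) :
    (∀ u v, (tadpole 3 l).Adj u v → κ u ≠ κ v) ↔
      (κ (.inl 0) ≠ κ (.inl 1) ∧ κ (.inl 0) ≠ κ (.inl 2) ∧ κ (.inl 1) ≠ κ (.inl 2)) ∧
        AvoidsHead (κ (.inl 0)) (κ ∘ Sum.inr) ∧ IsProperWord (κ ∘ Sum.inr) := by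
  have hinl : ∀ i j, (tadpole 3 l).Adj (.inl i) (.inl j) ↔ i ≠ j := by
    intro i j
    simp [tadpole, SimpleGraph.cycleGraph_three_eq_top]
  have hinr : ∀ i j, (tadpole 3 l).Adj (.inr i) (.inr j) ↔
      i.val + 1 = j.val ∨ j.val + 1 = i.val := by
    intro i j
    simp [tadpole, SimpleGraph.pathGraph_adj]
  have hlr : ∀ i j, (tadpole 3 l).Adj (.inl i) (.inr j) ↔ i.val = 0 ∧ j.val = 0 := by
    intro i j
    simp [tadpole, SimpleGraph.sum, and_comm]
  constructor
  · intro h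
    refine ⟨⟨h _ _ ((hinl _ _).mpr (by decide)), h _ _ ((hinl _ _).mpr (by decide)),
      h _ _ ((hinl _ _).mpr (by decide))⟩, fun j hj => h _ _ ((hlr _ _).mpr ⟨rfl, hj⟩),
      fun i j hij => h _ _ ((hinr _ _).mpr (Or.inl hij))⟩
  · rintro ⟨⟨h01, h02, h12⟩, hA, hP⟩ (i | i) (j | j) hadj
    · rw [hinl] at hadj
      have h10 := h01.symm
      have h20 := h02.symm
      have h21 := h12.symm
      fin_cases i <;> fin_cases j <;> first | assumption | exact absurd rfl hadj
    · rw [hlr] at hadj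
      obtain rfl : i = 0 := Fin.ext hadj.1
      exact hA j hadj.2
    · have h := (hlr _ _).mp hadj.symm
      obtain rfl : j = 0 := Fin.ext h.1
      exact (hA i h.2).symm
    · rcases (hinr _ _).mp hadj with h | h
      · exact hP i j h
      · exact (hP j i h).symm

-- Colorings are grouped by the colors `a, b, c` of the triangle; the attaching vertex, colored `a`,
-- together with the path forms a proper word with head `a`.
open Classical in
theorem sum_tadpole_three {A ι : Type*} [CommRing A] [Fintype ι] (x : ι → A) (l : ℕ) :
    ∑ κ : Fin 3 ⊕ Fin l → ι with ∀ u v, (tadpole 3 l).Adj u v → κ u ≠ κ v, ∏ v, x (κ v) =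
      ∑ a, ∑ b, ∑ c, (if a ≠ b ∧ a ≠ c ∧ b ≠ c then x b * x c * headSum x l a else 0) := by
  rw [sum_filter, ← (Equiv.sumArrowEquivProdArrow (Fin 3) (Fin l) ι).symm.sum_comp,
    Fintype.sum_prod_type, ← (Fin.consEquiv (fun _ => ι)).sum_comp, Fintype.sum_prod_type]
  refine sum_congr rfl fun a _ => ?_
  rw [← (Fin.consEquiv (fun _ => ι)).sum_comp, Fintype.sum_prod_type]
  refine sum_congr rfl fun b _ => ?_
  rw [← (Equiv.funUnique (Fin 1) ι).symm.sum_comp]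
  refine sum_congr rfl fun c _ => ?_
  simp only [tadpole_three_proper_iff, Fintype.prod_sum_type, Fin.prod_univ_three]
  change (∑ w : Fin l → ι, if (a ≠ b ∧ a ≠ c ∧ b ≠ c) ∧ AvoidsHead a w ∧ IsProperWord w then
    x a * x b * x c * ∏ i, x (w i) else 0) = _
  split_ifs with h
  · rw [headSum, sum_filter, mul_sum, mul_sum]
    refine sum_congr rfl fun w _ => ?_
    simp only [h, ne_eq, not_false_eq_true, and_self, true_and]
    split_ifs <;> ring
  · simp [h]

theorem chromaticSymm_tadpole_three {l n : ℕ} (hn : n = l + 3) :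
    chromaticSymm R (tadpole 3 l) =
      2 * ∑ I : Composition n with 3 ≤ lastPart I, weight I • elemSymmComp R I := by
  classical
  refine eq_of_restrictVars_eq fun S => ?_
  set x : S → Series R := fun a => MvPowerSeries.X (a : ℕ+)
  have hterm : ∀ I : Composition n, restrictVars S (weight I • elemSymmComp R I) =
      weightedTerm (fun k => PowerSeries.coeff k (elemGen x)) I.blocks := by
    intro I
    rw [map_zsmul, elemSymmComp, map_list_prod, List.map_map]
    simp only [Function.comp_def, restrictVars_elemSymm]
    rfl
  rw [map_mul, map_ofNat, map_sum, sum_congr rfl fun I _ => hterm I,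
    sum_filter_three_le_lastPart (by omega), weightedSum_coeff_elemGen,
    weightedSum_coeff_elemGen, restrictVars_chromaticSymm]
  rw [show n - 2 = l + 1 by omega, hn, ← sum_triangle_headSum]
  convert sum_tadpole_three x l

end Chromatic

end

theorem mainTheorem8 (R : Type*) [CommRing R] (n : ℕ) (hn : 3 ≤ n) :
    Chromatic.chromaticSymm R (Chromatic.tadpole 3 (n - 3)) =
      2 * ∑ I : Composition n with 3 ≤ Chromatic.lastPart I,
        Chromatic.weight I • Chromatic.elemSymmComp R I := by
  exact Chromatic.chromaticSymm_tadpole_three (by omega)
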